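/- Let $\varepsilon\in(0,1)$. There is $\Delta_0=\Delta_0(\varepsilon)$ such that the following holds for every integer $\Delta\ge\Delta_0$. Let $k$ be a positive integer with $(1-\varepsilon)k\ln k\ge\Delta$, set $\ell:=\Delta^{\varepsilon/2}$, and let $G$ be a finite triangle-free graph of maximum degree at most $\Delta$. Then, for every $\delta\in(0,1)$ and every vertex $v\in V(G)$, the graph $G\setminus v$ (that is, $G$ with the vertex $v$ deleted) has a proper $k$-colouring, and the uniformly random proper $k$-colouring $\boldsymbol{\sigma}$ of $G\setminus v$ satisfies \[ \Pr\bigl[\ell_{\boldsymbol{\sigma}}(v)<(1-\delta)\ell\bigr]\le 2\,\mathrm{e}^{-\delta^2\ell/2}, \] where, for a proper colouring $\sigma\colon V(G)\setminus\{v\}\to\{1,\dots,k\}$ of $G\setminus v$, $\ell_\sigma(v):=\bigl|\{1,\dots,k\}\setminus\sigma(N_G(v))\bigr|$ is the number of colours available for $v$ given $\sigma$. -/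

import Mathlib

universe u

namespace SparseColouring

variable {V : Type u}

/-- `G ∖ v`: the graph obtained from `G` by deleting the vertex `v`. -/
abbrev deleteVertex (G : SimpleGraph V) (v : V) : SimpleGraph ({v}ᶜ : Set V) :=
  G.induce {v}ᶜ

/-- The colours that the colouring `σ` of `G ∖ v` leaves available for `v`: all the `k` colours
except those that `σ` gives to the neighbours of `v` in `G`. -/
def availableColours (G : SimpleGraph V) {k : ℕ} (v : V)
    (σ : (deleteVertex G v).Coloring (Fin k)) : Set (Fin k) :=
  Set.univ \ (σ '' {u | G.Adj v u})

/-- The number of colours available for `v` given `σ`. -/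
noncomputable def listSize (G : SimpleGraph V) {k : ℕ} (v : V)
    (σ : (deleteVertex G v).Coloring (Fin k)) : ℕ :=
  (availableColours G v σ).ncard

/-- The uniform distribution on the proper `k`-colourings of a finite graph that has one. -/
noncomputable def uniformColouring {W : Type u} [Finite W] (H : SimpleGraph W) (k : ℕ)
    [Nonempty (H.Coloring (Fin k))] : PMF (H.Coloring (Fin k)) :=
  haveI : Finite (H.Coloring (Fin k)) := DFunLike.finite _
  letI := Fintype.ofFinite (H.Coloring (Fin k))
  PMF.uniformOfFintype (H.Coloring (Fin k))

/-- The probability of the event `A` under the distribution `p`. -/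
noncomputable def prob {Ω : Type u} (p : PMF Ω) (A : Set Ω) : ℝ :=
  (p.toOuterMeasure A).toReal

end SparseColouring

/-!
Induction on the vertex set, for uniformly random proper colourings of induced subgraphs. Condition
on the colours outside the neighbourhood of `v`. Since `G` is triangle-free, the neighbours of `v`
then choose their colours independently, each uniformly from its own list of free colours. If few of
these lists are short, then the expected number of colours left unused is at least
`κ * exp (-Δ (1 + θ) / κ)` with `κ = (1 - θ) k`, which exceeds `k ^ η` for every `η < ε` when
`Δ ≤ (1 - ε) k log k` and `θ` is small. The events that a given colour is unused are negatively
correlated, so a Chernoff bound makes fewer than `k ^ η` unused colours exponentially unlikely.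

That few lists are short comes from the induction hypothesis. Colouring a neighbour `u` last, the
uniform colouring is the one without `u` biased by the number of colours free for `u`. A list of
fewer than `t` colours is thus rare twice over: by the induction hypothesis, and by its weight, at
most `t / T` when a typical list has `T = k ^ η` colours. Markov's inequality then bounds the number
of neighbours with short lists.
-/

namespace SparseColouring

open Finset Function

section Resampling

variable {ι C M : Type*} [Fintype ι] [DecidableEq ι] [Fintype C] [AddCommMonoid M]

lemma sum_sum_updateFinset (U : Finset ι) (F : (ι → C) → (U → C) → M) :
    ∑ f, ∑ g, F (updateFinset f U g) (U.restrict f) = ∑ f, ∑ g, F f g := by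
  let swap : (ι → C) × (U → C) → (ι → C) × (U → C) :=
    fun p => (updateFinset p.1 U p.2, U.restrict p.1)
  have hswap : Involutive swap := fun p => by
    simp only [swap, restrict_updateFinset, updateFinset_updateFinset_of_subset subset_rfl,
      updateFinset_restrict]
  simp only [← Fintype.sum_prod_type']
  exact Equiv.sum_comp hswap.toPerm fun p : (ι → C) × (U → C) => F p.1 p.2

lemma sum_sum_update (i : ι) (F : (ι → C) → C → M) :
    ∑ f, ∑ c, F (update f i c) (f i) = ∑ f, ∑ c, F f c := by
  let swap : (ι → C) × C → (ι → C) × C := fun p => (update p.1 i p.2, p.1 i)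
  have hswap : Involutive swap := fun p => by
    simp only [swap, update_self, update_idem, update_eq_self]
  simp only [← Fintype.sum_prod_type']
  exact Equiv.sum_comp hswap.toPerm fun p : (ι → C) × C => F p.1 p.2

variable [DecidableEq C]

lemma card_mul_card_eq_sum_updateFinset (U : Finset ι) (S : Finset (ι → C)) :
    Fintype.card (U → C) * #S = ∑ f : ι → C, #{g : U → C | updateFinset f U g ∈ S} := by
  simp only [card_filter]
  rw [sum_sum_updateFinset U fun f _ => if f ∈ S then 1 else 0]
  simp only [sum_const, card_univ, smul_eq_mul, ← mul_sum, sum_boole, filter_univ_mem, Nat.cast_id]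

lemma card_mul_card_eq_sum_update (i : ι) (S : Finset (ι → C)) :
    Fintype.card C * #S = ∑ f : ι → C, #{c : C | update f i c ∈ S} := by
  simp only [card_filter]
  rw [sum_sum_update i fun f _ => if f ∈ S then 1 else 0]
  simp only [sum_const, card_univ, smul_eq_mul, ← mul_sum, sum_boole, filter_univ_mem, Nat.cast_id]

lemma card_le_mul_card_of_forall_updateFinset [Nonempty C] (U : Finset ι)
    {S S' : Finset (ι → C)} {r : ℝ}
    (h : ∀ f, (#{g : U → C | updateFinset f U g ∈ S'} : ℝ) ≤
      r * #{g : U → C | updateFinset f U g ∈ S}) :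
    (#S' : ℝ) ≤ r * #S := by
  refine le_of_mul_le_mul_left ?_ (by positivity : (0 : ℝ) < Fintype.card (U → C))
  calc (Fintype.card (U → C) : ℝ) * #S'
      = ∑ f : ι → C, (#{g : U → C | updateFinset f U g ∈ S'} : ℝ) := by
        exact_mod_cast card_mul_card_eq_sum_updateFinset U S'
    _ ≤ ∑ f : ι → C, r * #{g : U → C | updateFinset f U g ∈ S} := sum_le_sum fun f _ => h f
    _ = r * (Fintype.card (U → C) * #S : ℕ) := by
        rw [card_mul_card_eq_sum_updateFinset U S, Nat.cast_sum, mul_sum]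
    _ = Fintype.card (U → C) * (r * #S) := by push_cast; ring

end Resampling

section Occupancy

lemma prod_add_sum_mul_prod_erase_le_prod_add {ι R : Type*} [DecidableEq ι] [CommSemiring R]
    [PartialOrder R] [IsOrderedRing R] {s : Finset ι} {x y : ι → R} (hx : ∀ i ∈ s, 0 ≤ x i)
    (hy : ∀ i ∈ s, 0 ≤ y i) :
    ∏ i ∈ s, x i + ∑ i ∈ s, y i * ∏ j ∈ s.erase i, x j ≤ ∏ i ∈ s, (x i + y i) := by
  induction s using Finset.induction_on with
  | empty => simp
  | insert a s ha ih =>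
    rw [forall_mem_insert] at hx hy
    have herase : ∑ i ∈ s, y i * ∏ j ∈ (insert a s).erase i, x j =
        x a * ∑ i ∈ s, y i * ∏ j ∈ s.erase i, x j := by
      rw [mul_sum]
      refine sum_congr rfl fun i hi => ?_
      rw [erase_insert_of_ne (ne_of_mem_of_not_mem hi ha).symm,
        prod_insert (mt mem_of_mem_erase ha), mul_left_comm]
    have hcross : 0 ≤ y a * ∑ i ∈ s, y i * ∏ j ∈ s.erase i, x j :=
      mul_nonneg hy.1 (sum_nonneg fun i hi => mul_nonneg (hy.2 i hi)
        (prod_nonneg fun j hj => hx.2 j (mem_of_mem_erase hj)))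
    rw [prod_insert ha, sum_insert ha, erase_insert ha, herase, prod_insert ha]
    calc x a * ∏ i ∈ s, x i + (y a * ∏ i ∈ s, x i + x a * ∑ i ∈ s, y i * ∏ j ∈ s.erase i, x j)
        ≤ x a * ∏ i ∈ s, x i + (y a * ∏ i ∈ s, x i + x a * ∑ i ∈ s, y i * ∏ j ∈ s.erase i, x j)
          + y a * ∑ i ∈ s, y i * ∏ j ∈ s.erase i, x j := le_add_of_nonneg_right hcross
      _ = (x a + y a) * (∏ i ∈ s, x i + ∑ i ∈ s, y i * ∏ j ∈ s.erase i, x j) := by ring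
      _ ≤ (x a + y a) * ∏ i ∈ s, (x i + y i) :=
        mul_le_mul_of_nonneg_left (ih hx.2 hy.2) (add_nonneg hx.1 hy.1)

lemma sum_mul_prod_erase_le_prod {C : Type*} [Fintype C] [DecidableEq C] {w x : C → ℝ}
    (hw : ∀ c, 0 ≤ w c) (hw1 : ∑ c, w c = 1) (hx : ∀ c, 0 ≤ x c) (hx1 : ∀ c, x c ≤ 1) :
    ∑ c, w c * ∏ d ∈ univ.erase c, x d ≤ ∏ c, (x c + w c * (1 - x c)) := by
  refine le_trans (le_of_eq ?_) (prod_add_sum_mul_prod_erase_le_prod_add (fun c _ => hx c)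
    fun c _ => mul_nonneg (hw c) (sub_nonneg.2 (hx1 c)))
  have hterm : ∀ c, w c * (1 - x c) * ∏ d ∈ univ.erase c, x d =
      w c * ∏ d ∈ univ.erase c, x d - w c * ∏ d, x d := fun c => by
    rw [← mul_prod_erase univ x (mem_univ c)]; ring
  simp only [hterm, sum_sub_distrib, ← sum_mul, hw1, one_mul, add_sub_cancel]

lemma exp_neg_card_filter_not {C : Type*} [Fintype C] (p : C → Prop) [DecidablePred p] :
    Real.exp (-#{c | ¬p c}) = ∏ c, (if p c then 1 else Real.exp (-1)) := by
  rw [prod_ite, prod_const_one, one_mul, prod_const, ← Real.exp_nat_mul, mul_neg_one]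

variable {ι C : Type*} [Fintype ι] [DecidableEq ι] [Fintype C] {w : ι → C → ℝ}

lemma sum_prod_mul_eq_sum_prod_mul_sum_update (i : ι) (hw1 : ∑ c, w i c = 1)
    (F : (ι → C) → ℝ) :
    ∑ f, (∏ j, w j (f j)) * F f = ∑ f, (∏ j, w j (f j)) * ∑ c, w i c * F (update f i c) := by
  have hweight : ∀ f c, (∏ j, w j (f j)) * w i c =
      (∏ j, w j (update f i c j)) * w i (f i) := fun f c => by
    rw [← mul_prod_erase univ _ (mem_univ i), ← mul_prod_erase univ _ (mem_univ i),
      update_self, prod_congr rfl fun j hj =>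
        congrArg (w j) (update_of_ne (ne_of_mem_erase hj) c f)]
    ring
  calc ∑ f, (∏ j, w j (f j)) * F f
      = ∑ f, ∑ c, (∏ j, w j (f j)) * w i c * F f := by
        simp only [← sum_mul, ← mul_sum, hw1, mul_one]
    _ = ∑ f, ∑ c, (∏ j, w j (update f i c j)) * w i (f i) * F (update f i c) :=
        (sum_sum_update i fun f c => (∏ j, w j (f j)) * w i c * F f).symm
    _ = ∑ f, (∏ j, w j (f j)) * ∑ c, w i c * F (update f i c) := by
        simp only [← hweight, mul_sum, mul_assoc]

variable [DecidableEq C]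

/-- Negative correlation, proved one coordinate of `S` at a time: fixing `f i = d` turns the
factor of `d` into `1`, which amounts to replacing `b d` by `1`. -/
lemma sum_prod_mul_prod_unused_le (hw : ∀ i c, 0 ≤ w i c) (hw1 : ∀ i, ∑ c, w i c = 1)
    (S : Finset ι) (b : C → ℝ) (hb : ∀ c, 0 ≤ b c) (hb1 : ∀ c, b c ≤ 1) :
    ∑ f : ι → C, (∏ i, w i (f i)) * ∏ c, (if ∃ i ∈ S, f i = c then 1 else b c) ≤
      ∏ c, (1 - (∏ i ∈ S, (1 - w i c)) * (1 - b c)) := by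
  have hle : ∀ i c, w i c ≤ 1 := fun i c =>
    (single_le_sum (fun d _ => hw i d) (mem_univ c)).trans_eq (hw1 i)
  induction S using Finset.induction_on generalizing b with
  | empty =>
    have htotal : ∑ f : ι → C, ∏ i, w i (f i) = 1 := by
      simpa only [hw1, prod_const_one, Fintype.piFinset_univ] using
        (prod_univ_sum (fun _ : ι => (univ : Finset C)) w).symm
    simp [← sum_mul, htotal]
  | insert a S ha ih =>
    set p : C → ℝ := fun c => ∏ i ∈ S, (1 - w i c) with hp
    have hp0 : ∀ c, 0 ≤ p c := fun c => prod_nonneg fun i _ => sub_nonneg.2 (hle i c)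
    have hp1 : ∀ c, p c ≤ 1 := fun c =>
      prod_le_one (fun i _ => sub_nonneg.2 (hle i c)) fun i _ => sub_le_self 1 (hw i c)
    have hfix : ∀ (f : ι → C) (d : C),
        ∏ c, (if ∃ i ∈ insert a S, update f a d i = c then 1 else b c) =
          ∏ c, (if ∃ i ∈ S, f i = c then 1 else update b d 1 c) := fun f d => by
      refine prod_congr rfl fun c _ => ?_
      have hS : (∃ i ∈ S, update f a d i = c) ↔ ∃ i ∈ S, f i = c :=
        exists_congr fun i => and_congr_right fun hi => by
          rw [update_of_ne (ne_of_mem_of_not_mem hi ha)]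
      rcases eq_or_ne c d with rfl | hc
      · simp
      · simp [hS, hc, hc.symm]
    have hprod : ∀ d, ∏ c, (1 - p c * (1 - update b d 1 c)) =
        ∏ c ∈ univ.erase d, (1 - p c * (1 - b c)) := fun d => by
      rw [← mul_prod_erase univ _ (mem_univ d), update_self, sub_self, mul_zero, sub_zero, one_mul]
      exact prod_congr rfl fun c hc => by rw [update_of_ne (ne_of_mem_erase hc)]
    calc ∑ f : ι → C, (∏ i, w i (f i)) *
          ∏ c, (if ∃ i ∈ insert a S, f i = c then 1 else b c)
        = ∑ d, w a d * ∑ f : ι → C, (∏ i, w i (f i)) *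
            ∏ c, (if ∃ i ∈ S, f i = c then 1 else update b d 1 c) := by
          rw [sum_prod_mul_eq_sum_prod_mul_sum_update a (hw1 a)]
          simp only [hfix, mul_sum]
          rw [sum_comm]
          simp only [mul_left_comm]
      _ ≤ ∑ d, w a d * ∏ c ∈ univ.erase d, (1 - p c * (1 - b c)) := by
          refine sum_le_sum fun d _ => mul_le_mul_of_nonneg_left ?_ (hw a d)
          rw [← hprod]
          refine ih (update b d 1) (fun c => ?_) fun c => ?_
          · exact le_update_iff.2 ⟨zero_le_one, fun c _ => hb c⟩ c
          · exact update_le_iff.2 ⟨le_rfl, fun c _ => hb1 c⟩ c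
      _ ≤ ∏ c, (1 - p c * (1 - b c) + w a c * (1 - (1 - p c * (1 - b c)))) :=
          sum_mul_prod_erase_le_prod (hw a) (hw1 a)
            (fun c => sub_nonneg.2 (mul_le_one₀ (hp1 c) (sub_nonneg.2 (hb1 c))
              (sub_le_self 1 (hb c))))
            fun c => sub_le_self 1 (mul_nonneg (hp0 c) (sub_nonneg.2 (hb1 c)))
      _ = ∏ c, (1 - (∏ i ∈ insert a S, (1 - w i c)) * (1 - b c)) := by
          simp only [prod_insert ha, hp]
          exact prod_congr rfl fun c _ => by ring

lemma sum_prod_mul_exp_neg_card_unused_le (hw : ∀ i c, 0 ≤ w i c) (hw1 : ∀ i, ∑ c, w i c = 1) :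
    ∑ f : ι → C, (∏ i, w i (f i)) * Real.exp (-#{c | ∀ i, f i ≠ c}) ≤
      Real.exp (-(∑ c, ∏ i, (1 - w i c)) / 2) := by
  have hcount : ∀ f : ι → C, Real.exp (-#{c | ∀ i, f i ≠ c}) =
      ∏ c, (if ∃ i, f i = c then 1 else Real.exp (-1)) := fun f => by
    simpa only [not_exists] using exp_neg_card_filter_not fun c => ∃ i, f i = c
  have hexp : Real.exp (-1) ≤ 1 / 2 := by
    rw [Real.exp_neg, one_div]
    exact inv_anti₀ two_pos (by linarith [Real.add_one_le_exp (1 : ℝ)])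
  have hle : ∀ i c, w i c ≤ 1 := fun i c =>
    (single_le_sum (fun d _ => hw i d) (mem_univ c)).trans_eq (hw1 i)
  have hp0 : ∀ c, 0 ≤ ∏ i, (1 - w i c) := fun c => prod_nonneg fun i _ => sub_nonneg.2 (hle i c)
  have hp1 : ∀ c, ∏ i, (1 - w i c) ≤ 1 := fun c =>
    prod_le_one (fun i _ => sub_nonneg.2 (hle i c)) fun i _ => sub_le_self 1 (hw i c)
  simp only [hcount]
  calc ∑ f : ι → C, (∏ i, w i (f i)) * ∏ c, (if ∃ i, f i = c then 1 else Real.exp (-1))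
      ≤ ∏ c, (1 - (∏ i, (1 - w i c)) * (1 - Real.exp (-1))) := by
        simpa only [mem_univ, true_and] using sum_prod_mul_prod_unused_le hw hw1 univ
          (fun _ => Real.exp (-1)) (fun _ => (Real.exp_pos _).le)
          fun _ => hexp.trans one_half_lt_one.le
    _ ≤ ∏ c, Real.exp (-(∏ i, (1 - w i c)) / 2) := by
        refine prod_le_prod (fun c _ => ?_) fun c _ => ?_
        · exact sub_nonneg.2 (mul_le_one₀ (hp1 c) (by linarith)
            (sub_le_self 1 (Real.exp_pos _).le))
        · linarith [mul_le_mul_of_nonneg_left hexp (hp0 c),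
            Real.add_one_le_exp (-(∏ i, (1 - w i c)) / 2)]
    _ = Real.exp (-(∑ c, ∏ i, (1 - w i c)) / 2) := by
        rw [← Real.exp_sum, ← sum_neg_distrib, sum_div]

lemma sum_prod_filter_card_unused_lt_le (hw : ∀ i c, 0 ≤ w i c) (hw1 : ∀ i, ∑ c, w i c = 1)
    (T : ℝ) :
    ∑ f : ι → C with (#{c | ∀ i, f i ≠ c} : ℝ) < T, ∏ i, w i (f i) ≤
      Real.exp (T - (∑ c, ∏ i, (1 - w i c)) / 2) := by
  have hnonneg : ∀ f : ι → C, 0 ≤ ∏ i, w i (f i) := fun f => prod_nonneg fun i _ => hw i (f i)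
  calc ∑ f : ι → C with (#{c | ∀ i, f i ≠ c} : ℝ) < T, ∏ i, w i (f i)
      ≤ ∑ f : ι → C with (#{c | ∀ i, f i ≠ c} : ℝ) < T,
          (∏ i, w i (f i)) * Real.exp (T - #{c | ∀ i, f i ≠ c}) :=
        sum_le_sum fun f hf => le_mul_of_one_le_right (hnonneg f)
          (Real.one_le_exp (sub_nonneg.2 (mem_filter.1 hf).2.le))
    _ ≤ ∑ f : ι → C, (∏ i, w i (f i)) * Real.exp (T - #{c | ∀ i, f i ≠ c}) :=
        sum_le_sum_of_subset_of_nonneg (filter_subset _ _) fun f _ _ =>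
          mul_nonneg (hnonneg f) (Real.exp_pos _).le
    _ = Real.exp T * ∑ f : ι → C, (∏ i, w i (f i)) * Real.exp (-#{c | ∀ i, f i ≠ c}) := by
        simp only [sub_eq_add_neg, Real.exp_add, mul_sum, mul_left_comm]
    _ ≤ Real.exp T * Real.exp (-(∑ c, ∏ i, (1 - w i c)) / 2) :=
        mul_le_mul_of_nonneg_left (sum_prod_mul_exp_neg_card_unused_le hw hw1) (Real.exp_pos T).le
    _ = Real.exp (T - (∑ c, ∏ i, (1 - w i c)) / 2) := by
        rw [← Real.exp_add, neg_div, ← sub_eq_add_neg]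

lemma exp_neg_mul_le_one_sub {t x : ℝ} (ht : 1 < t) (hx : 0 ≤ x) (hxt : x ≤ 1 / t) :
    Real.exp (-(t / (t - 1) * x)) ≤ 1 - x := by
  have ht1 : 0 < t - 1 := sub_pos.2 ht
  have hxt' : x * t ≤ 1 := (le_div_iff₀ (zero_lt_one.trans ht)).1 hxt
  have hprod : 1 ≤ (1 - x) * (t / (t - 1) * x + 1) := by
    have hexpand : (1 - x) * (t / (t - 1) * x + 1) = 1 + x * (1 - x * t) / (t - 1) := by
      field_simp
      ring
    rw [hexpand]
    exact le_add_of_nonneg_right (div_nonneg (mul_nonneg hx (sub_nonneg.2 hxt')) ht1.le)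
  have hpos : 0 < t / (t - 1) * x + 1 := by positivity
  rw [Real.exp_neg]
  exact (inv_anti₀ hpos (Real.add_one_le_exp _)).trans ((inv_le_iff_one_le_mul₀ hpos).2 hprod)

/-- Jensen's inequality for `exp (-·)`, through its tangent at `S / κ`. -/
lemma mul_exp_neg_div_le_sum_exp_neg {α : Type*} {s : Finset α} {x : α → ℝ} {κ S : ℝ}
    (hκ : 0 < κ) (hs : κ ≤ #s) (hS : 0 ≤ S) (hx : ∑ a ∈ s, x a ≤ S) :
    κ * Real.exp (-(S / κ)) ≤ ∑ a ∈ s, Real.exp (-x a) := by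
  have htangent : ∀ a, Real.exp (-(S / κ)) * (1 + S / κ - x a) ≤ Real.exp (-x a) := fun a => by
    calc Real.exp (-(S / κ)) * (1 + S / κ - x a)
        ≤ Real.exp (-(S / κ)) * Real.exp (S / κ - x a) :=
          mul_le_mul_of_nonneg_left (by linarith [Real.add_one_le_exp (S / κ - x a)])
            (Real.exp_pos _).le
      _ = Real.exp (-x a) := by rw [← Real.exp_add]; ring_nf
  have hκS : κ * (1 + S / κ) = κ + S := by field_simp
  have hsum : κ + S ≤ #s * (1 + S / κ) :=
    hκS ▸ mul_le_mul_of_nonneg_right hs (by positivity)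
  calc κ * Real.exp (-(S / κ))
      ≤ Real.exp (-(S / κ)) * (#s * (1 + S / κ) - ∑ a ∈ s, x a) := by
        rw [mul_comm]
        exact mul_le_mul_of_nonneg_left (by linarith) (Real.exp_pos _).le
    _ = ∑ a ∈ s, Real.exp (-(S / κ)) * (1 + S / κ - x a) := by
        rw [← mul_sum, sum_sub_distrib, sum_const, nsmul_eq_mul]
    _ ≤ ∑ a ∈ s, Real.exp (-x a) := sum_le_sum fun a _ => htangent a

lemma mul_exp_neg_le_sum_prod_one_sub {ι C : Type*} [Fintype ι] [Fintype C] {w : ι → C → ℝ}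
    (hw : ∀ i c, 0 ≤ w i c) (hw1 : ∀ i, ∑ c, w i c ≤ 1) {t κ : ℝ} (ht : 1 < t) (hκ : 0 < κ)
    {K : Finset C} (hK : κ ≤ #K) (hwK : ∀ i, ∀ c ∈ K, w i c ≤ 1 / t) :
    κ * Real.exp (-(Fintype.card ι * (t / (t - 1)) / κ)) ≤ ∑ c ∈ K, ∏ i, (1 - w i c) := by
  have hratio : 0 ≤ t / (t - 1) := div_nonneg (zero_le_one.trans ht.le) (sub_nonneg.2 ht.le)
  have hmass : ∑ c ∈ K, ∑ i, t / (t - 1) * w i c ≤ Fintype.card ι * (t / (t - 1)) := by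
    rw [sum_comm, ← nsmul_eq_mul, ← card_univ, ← sum_const]
    refine sum_le_sum fun i _ => ?_
    rw [← mul_sum]
    exact mul_le_of_le_one_right hratio
      ((sum_le_univ_sum_of_nonneg fun c => hw i c).trans (hw1 i))
  refine (mul_exp_neg_div_le_sum_exp_neg hκ hK (by positivity) hmass).trans
    (sum_le_sum fun c hc => ?_)
  rw [← sum_neg_distrib, Real.exp_sum]
  exact prod_le_prod (fun i _ => (Real.exp_pos _).le) fun i _ =>
    exp_neg_mul_le_one_sub ht (hw i c) (hwK i c hc)

end Occupancy

section RandomLists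

variable {C : Type*} [DecidableEq C]

/-- The probability that a uniformly random element of the list `L` is `c`, identically `0` when
`L` is empty. -/
noncomputable def uniformWeight (L : Finset C) (c : C) : ℝ :=
  if c ∈ L then (#L : ℝ)⁻¹ else 0

lemma uniformWeight_nonneg (L : Finset C) (c : C) : 0 ≤ uniformWeight L c := by
  unfold uniformWeight
  split_ifs <;> positivity

lemma prod_uniformWeight {ι : Type*} [Fintype ι] [DecidableEq ι] {L : ι → Finset C} {g : ι → C}
    (hg : g ∈ Fintype.piFinset L) :
    ∏ i, uniformWeight (L i) (g i) = (#(Fintype.piFinset L) : ℝ)⁻¹ := by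
  rw [Fintype.card_piFinset, Nat.cast_prod, ← prod_inv_distrib]
  exact prod_congr rfl fun i _ => if_pos (Fintype.mem_piFinset.1 hg i)

variable [Fintype C]

lemma sum_uniformWeight {L : Finset C} (hL : L.Nonempty) : ∑ c, uniformWeight L c = 1 := by
  simp only [uniformWeight, sum_ite_mem, univ_inter, sum_const, nsmul_eq_mul]
  exact mul_inv_cancel₀ (Nat.cast_ne_zero.2 hL.card_ne_zero)

lemma sum_uniformWeight_le_one (L : Finset C) : ∑ c, uniformWeight L c ≤ 1 := by
  rcases L.eq_empty_or_nonempty with rfl | hL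
  · simp [uniformWeight]
  · exact (sum_uniformWeight hL).le

variable {ι : Type*} [Fintype ι]

lemma mul_exp_neg_le_sum_prod_one_sub_uniformWeight (L : ι → Finset C) {t κ : ℝ} (ht : 1 < t)
    (hκ : 0 < κ) (hshort : t * #{i | (#(L i) : ℝ) < t} ≤ Fintype.card C - κ) :
    κ * Real.exp (-(Fintype.card ι * (t / (t - 1)) / κ)) ≤
      ∑ c, ∏ i, (1 - uniformWeight (L i) c) := by
  have hle : ∀ i c, uniformWeight (L i) c ≤ 1 := fun i c =>
    (single_le_sum (fun d _ => uniformWeight_nonneg (L i) d) (mem_univ c)).trans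
      (sum_uniformWeight_le_one (L i))
  set B : Finset C := ({i | (#(L i) : ℝ) < t} : Finset ι).biUnion L
  have hcardB : (#B : ℝ) ≤ t * #{i | (#(L i) : ℝ) < t} := by
    calc (#B : ℝ) ≤ ∑ i with (#(L i) : ℝ) < t, (#(L i) : ℝ) := by
          exact_mod_cast card_biUnion_le
      _ ≤ ∑ i with (#(L i) : ℝ) < t, t := sum_le_sum fun i hi => (mem_filter.1 hi).2.le
      _ = t * #{i | (#(L i) : ℝ) < t} := by rw [sum_const, nsmul_eq_mul, mul_comm]
  have hcardBc : κ ≤ #Bᶜ := by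
    have hcompl : (#B : ℝ) + #Bᶜ = Fintype.card C := by exact_mod_cast card_add_card_compl B
    linarith
  have hlong : ∀ i, ∀ c ∈ Bᶜ, uniformWeight (L i) c ≤ 1 / t := fun i c hc => by
    unfold uniformWeight
    split_ifs with hcL
    · have hti : t ≤ #(L i) := not_lt.1 fun hlt =>
        mem_compl.1 hc (mem_biUnion.2 ⟨i, mem_filter.2 ⟨mem_univ i, hlt⟩, hcL⟩)
      rw [one_div]
      exact inv_anti₀ (zero_lt_one.trans ht) hti
    · exact one_div_nonneg.2 (zero_le_one.trans ht.le)
  exact (mul_exp_neg_le_sum_prod_one_sub (fun i => uniformWeight_nonneg (L i))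
    (fun i => sum_uniformWeight_le_one (L i)) ht hκ hcardBc hlong).trans
    (sum_le_univ_sum_of_nonneg fun c => prod_nonneg fun i _ => sub_nonneg.2 (hle i c))

variable [DecidableEq ι]

lemma card_piFinset_filter_unused_lt_le (L : ι → Finset C) (T : ℝ) :
    (#{g ∈ Fintype.piFinset L | (#{c | ∀ i, g i ≠ c} : ℝ) < T} : ℝ) ≤
      Real.exp (T - (∑ c, ∏ i, (1 - uniformWeight (L i) c)) / 2) * #(Fintype.piFinset L) := by
  rcases (Fintype.piFinset L).eq_empty_or_nonempty with hempty | hne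
  · simp [hempty]
  have hL : ∀ i, (L i).Nonempty := Fintype.piFinset_nonempty.1 hne
  rw [← div_le_iff₀ (Nat.cast_pos.2 hne.card_pos), div_eq_mul_inv, ← nsmul_eq_mul, ← sum_const]
  calc ∑ g ∈ Fintype.piFinset L with (#{c | ∀ i, g i ≠ c} : ℝ) < T,
        (#(Fintype.piFinset L) : ℝ)⁻¹
      = ∑ g ∈ Fintype.piFinset L with (#{c | ∀ i, g i ≠ c} : ℝ) < T,
          ∏ i, uniformWeight (L i) (g i) :=
        sum_congr rfl fun g hg => (prod_uniformWeight (mem_filter.1 hg).1).symm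
    _ ≤ ∑ g : ι → C with (#{c | ∀ i, g i ≠ c} : ℝ) < T, ∏ i, uniformWeight (L i) (g i) :=
        sum_le_sum_of_subset_of_nonneg (filter_subset_filter _ (subset_univ _)) fun g _ _ =>
          prod_nonneg fun i _ => uniformWeight_nonneg (L i) (g i)
    _ ≤ _ := sum_prod_filter_card_unused_lt_le (fun i => uniformWeight_nonneg (L i))
        (fun i => sum_uniformWeight (hL i)) T

lemma card_piFinset_filter_unused_lt_le_of_few_short (L : ι → Finset C) {t κ D : ℝ} (ht : 1 < t)
    (hκ : 0 < κ) (hD : Fintype.card ι ≤ D)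
    (hshort : t * #{i | (#(L i) : ℝ) < t} ≤ Fintype.card C - κ) (T : ℝ) :
    (#{g ∈ Fintype.piFinset L | (#{c | ∀ i, g i ≠ c} : ℝ) < T} : ℝ) ≤
      Real.exp (T - κ * Real.exp (-(D * (t / (t - 1)) / κ)) / 2) * #(Fintype.piFinset L) := by
  have : 0 ≤ t / (t - 1) := div_nonneg (zero_le_one.trans ht.le) (sub_nonneg.2 ht.le)
  have hmean := mul_exp_neg_le_sum_prod_one_sub_uniformWeight L ht hκ hshort
  refine (card_piFinset_filter_unused_lt_le L T).trans ?_
  gcongr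
  refine le_trans ?_ hmean
  gcongr

end RandomLists

lemma card_filter_mul_le_sum {α : Type*} {s : Finset α} {p : α → Prop} [DecidablePred p]
    {x : α → ℝ} {r : ℝ} (hx : ∀ a ∈ s, 0 ≤ x a) (hp : ∀ a ∈ s, p a → r ≤ x a) :
    #{a ∈ s | p a} * r ≤ ∑ a ∈ s, x a := by
  rw [← nsmul_eq_mul]
  refine (card_nsmul_le_sum _ x r fun a ha => ?_).trans
    (sum_le_sum_of_subset_of_nonneg (filter_subset p s) fun a ha _ => hx a ha)
  exact hp a (mem_filter.1 ha).1 (mem_filter.1 ha).2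

section PartialColourings

variable {V : Type*} (G : SimpleGraph V) [DecidableRel G.Adj]

/-- The neighbours of `v` in `A`. -/
def nbrsIn (A : Finset V) (v : V) : Finset V :=
  {u ∈ A | G.Adj v u}

/-- The colours that `f` does not use on the neighbours of `v` in `A`: the list of `v`, given the
colouring `f` of `A`. -/
def freeColours {C : Type*} [Fintype C] [DecidableEq C] (f : V → C) (A : Finset V) (v : V) :
    Finset C :=
  {c | ∀ u ∈ nbrsIn G A v, f u ≠ c}

/-- The colourings of the subgraph of `G` induced by `A` with colours in `C`. They are encoded as
maps on all of `V`, so that each of them is counted once for every choice of colours off `A`; the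
uniform distribution on `properOn G C A` still induces the uniform one on the colourings of `A`. -/
def properOn [Fintype V] [DecidableEq V] (C : Type*) [Fintype C] [DecidableEq C]
    (A : Finset V) : Finset (V → C) :=
  {f | ∀ x ∈ A, ∀ y ∈ A, G.Adj x y → f x ≠ f y}

/-- In all but a proportion `q` of the colourings of `A`, the vertex `v` has at least `T` free
colours. -/
def MostlyFree [Fintype V] [DecidableEq V] (C : Type*) [Fintype C] [DecidableEq C]
    (T q : ℝ) (A : Finset V) (v : V) : Prop :=
  (#{f ∈ properOn G C A | (#(freeColours G f A v) : ℝ) < T} : ℝ) ≤ q * #(properOn G C A)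

variable {G}

section Neighbours

variable {A : Finset V} {u v : V}

lemma mem_nbrsIn : u ∈ nbrsIn G A v ↔ u ∈ A ∧ G.Adj v u :=
  mem_filter

lemma not_adj_of_mem_nbrsIn (hG : G.CliqueFree 3) {x y : V} (hx : x ∈ nbrsIn G A v)
    (hy : y ∈ nbrsIn G A v) : ¬G.Adj x y := fun hxy =>
  G.isIndepSet_neighborSet_of_triangleFree hG v (mem_nbrsIn.1 hx).2 (mem_nbrsIn.1 hy).2 hxy.ne hxy

lemma card_nbrsIn_le_maxDegree [Fintype V] (A : Finset V) (v : V) :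
    #(nbrsIn G A v) ≤ G.maxDegree := by
  refine (card_le_card fun u hu => ?_).trans (G.degree_le_maxDegree v)
  exact (G.mem_neighborFinset v u).2 (mem_nbrsIn.1 hu).2

variable [DecidableEq V]

lemma nbrsIn_erase_self : nbrsIn G (A.erase v) v = nbrsIn G A v := by
  ext u
  simp only [mem_nbrsIn, mem_erase, and_assoc, and_iff_right_iff_imp]
  exact fun hu => hu.2.ne'

lemma nbrsIn_sdiff_nbrsIn (hG : G.CliqueFree 3) (hu : u ∈ nbrsIn G A v) :
    nbrsIn G (A \ nbrsIn G A v) u = nbrsIn G A u := by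
  ext x
  simp only [mem_nbrsIn (v := u), mem_sdiff, and_assoc, and_congr_right_iff, and_iff_right_iff_imp]
  exact fun _ hux hx => not_adj_of_mem_nbrsIn hG hu hx hux

end Neighbours

variable {C : Type*} [Fintype C] [DecidableEq C] {A : Finset V} {u v : V}

section FreeColours

variable {f : V → C}

lemma mem_freeColours {c : C} : c ∈ freeColours G f A v ↔ ∀ u ∈ nbrsIn G A v, f u ≠ c :=
  mem_filter_univ c

lemma freeColours_congr {f' : V → C} {A' : Finset V} (hA : nbrsIn G A v = nbrsIn G A' v)
    (hf : ∀ u ∈ nbrsIn G A v, f u = f' u) : freeColours G f A v = freeColours G f' A' v := by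
  ext c
  simp only [mem_freeColours, ← hA]
  exact forall₂_congr fun u hu => by rw [hf u hu]

variable [DecidableEq V]

lemma freeColours_erase_self : freeColours G f (A.erase v) v = freeColours G f A v :=
  freeColours_congr nbrsIn_erase_self fun _ _ => rfl

lemma freeColours_update_self (c : C) :
    freeColours G (update f v c) A v = freeColours G f A v :=
  freeColours_congr rfl fun _ hu => update_of_ne (mem_nbrsIn.1 hu).2.ne' c f

lemma freeColours_updateFinset (hG : G.CliqueFree 3) (hu : u ∈ nbrsIn G A v)
    (g : nbrsIn G A v → C) :
    freeColours G (updateFinset f (nbrsIn G A v) g) A u =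
      freeColours G f (A \ nbrsIn G A v) u :=
  freeColours_congr (nbrsIn_sdiff_nbrsIn hG hu).symm fun _ hx =>
    dif_neg fun hxv => not_adj_of_mem_nbrsIn hG hu hxv (mem_nbrsIn.1 hx).2

lemma freeColours_updateFinset_self (g : nbrsIn G A v → C) :
    freeColours G (updateFinset f (nbrsIn G A v) g) A v = ({c | ∀ i, g i ≠ c} : Finset C) := by
  ext c
  simp only [mem_freeColours, mem_filter_univ, Subtype.forall]
  exact forall₂_congr fun u hu => by rw [updateFinset, dif_pos hu]

end FreeColours

variable [Fintype V] [DecidableEq V]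

section ProperColourings

lemma mem_properOn {f : V → C} :
    f ∈ properOn G C A ↔ ∀ x ∈ A, ∀ y ∈ A, G.Adj x y → f x ≠ f y :=
  mem_filter_univ f

lemma update_mem_properOn_insert (hu : u ∉ A) (f : V → C) (c : C) :
    update f u c ∈ properOn G C (insert u A) ↔
      f ∈ properOn G C A ∧ c ∈ freeColours G f A u := by
  have hne : ∀ x ∈ A, update f u c x = f x := fun x hx =>
    update_of_ne (ne_of_mem_of_not_mem hx hu) c f
  simp only [mem_properOn, mem_freeColours, mem_nbrsIn]
  constructor
  · refine fun h => ⟨fun x hx y hy hxy => ?_, fun x ⟨hx, hux⟩ => ?_⟩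
    · simpa only [hne x hx, hne y hy] using
        h x (mem_insert_of_mem hx) y (mem_insert_of_mem hy) hxy
    · simpa only [hne x hx, update_self] using
        h x (mem_insert_of_mem hx) u (mem_insert_self u A) hux.symm
  · rintro ⟨hproper, hfree⟩ x hx y hy hxy
    rcases mem_insert.1 hx with rfl | hxA <;> rcases mem_insert.1 hy with rfl | hyA
    · exact absurd hxy (G.irrefl)
    · simpa only [hne y hyA, update_self] using (hfree y ⟨hyA, hxy⟩).symm
    · simpa only [hne x hxA, update_self] using hfree x ⟨hxA, hxy.symm⟩
    · simpa only [hne x hxA, hne y hyA] using hproper x hxA y hyA hxy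

lemma updateFinset_mem_properOn (hG : G.CliqueFree 3) (f : V → C) (g : nbrsIn G A v → C) :
    updateFinset f (nbrsIn G A v) g ∈ properOn G C A ↔
      f ∈ properOn G C (A \ nbrsIn G A v) ∧
        g ∈ Fintype.piFinset fun u : nbrsIn G A v => freeColours G f (A \ nbrsIn G A v) u := by
  have hin : ∀ x (hx : x ∈ nbrsIn G A v),
      updateFinset f (nbrsIn G A v) g x = g ⟨x, hx⟩ := fun x hx => dif_pos hx
  have hout : ∀ x ∉ nbrsIn G A v, updateFinset f (nbrsIn G A v) g x = f x := fun x hx => dif_neg hx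
  rw [mem_properOn, mem_properOn, Fintype.mem_piFinset]
  constructor
  · refine fun h => ⟨fun x hx y hy hxy => ?_, fun u => mem_freeColours.2 fun x hx => ?_⟩
    · rw [mem_sdiff] at hx hy
      simpa only [hout x hx.2, hout y hy.2] using h x hx.1 y hy.1 hxy
    · obtain ⟨hxA, hux⟩ := mem_nbrsIn.1 hx
      rw [mem_sdiff] at hxA
      simpa only [hout x hxA.2, hin u u.2] using h x hxA.1 u (mem_nbrsIn.1 u.2).1 hux.symm
  · rintro ⟨hproper, hfree⟩ x hx y hy hxy
    have hfree' : ∀ u (hu : u ∈ nbrsIn G A v), ∀ w ∈ A, w ∉ nbrsIn G A v → G.Adj u w →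
        f w ≠ g ⟨u, hu⟩ := fun u hu w hw hwv huw =>
      mem_freeColours.1 (hfree ⟨u, hu⟩) w (mem_nbrsIn.2 ⟨mem_sdiff.2 ⟨hw, hwv⟩, huw⟩)
    by_cases hxv : x ∈ nbrsIn G A v <;> by_cases hyv : y ∈ nbrsIn G A v
    · exact absurd hxy (not_adj_of_mem_nbrsIn hG hxv hyv)
    · rw [hin x hxv, hout y hyv]
      exact (hfree' x hxv y hy hyv hxy).symm
    · rw [hin y hyv, hout x hxv]
      exact hfree' y hyv x hx hxv hxy.symm
    · rw [hout x hxv, hout y hyv]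
      exact hproper x (mem_sdiff.2 ⟨hx, hxv⟩) y (mem_sdiff.2 ⟨hy, hyv⟩) hxy

/-- A uniform colouring of `insert u A` restricts to a colouring of `A` biased by the number of
colours that are free for `u`. -/
lemma card_mul_card_properOn_insert (hu : u ∉ A) (P : ℕ → Prop) [DecidablePred P] :
    Fintype.card C * #{f ∈ properOn G C (insert u A) | P #(freeColours G f A u)} =
      ∑ f ∈ properOn G C A with P #(freeColours G f A u), #(freeColours G f A u) := by
  have hmem : ∀ (f : V → C) (c : C),
      update f u c ∈ {f ∈ properOn G C (insert u A) | P #(freeColours G f A u)} ↔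
        f ∈ {f ∈ properOn G C A | P #(freeColours G f A u)} ∧ c ∈ freeColours G f A u :=
    fun f c => by
      rw [mem_filter, mem_filter, update_mem_properOn_insert hu, freeColours_update_self,
        and_right_comm]
  rw [card_mul_card_eq_sum_update u]
  refine (sum_subset (subset_univ _) fun f _ hf => ?_).symm.trans (sum_congr rfl fun f hf => ?_)
  · exact card_eq_zero.2 (filter_false_of_mem fun c _ hc => hf ((hmem f c).1 hc).1)
  · simp only [hmem, hf, true_and, filter_univ_mem]

end ProperColourings

section SizeBiasing

variable {T q t : ℝ}

lemma MostlyFree.card_properOn_le (h : MostlyFree G C T q A u) (hT : 0 ≤ T)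
    (hq : q ≤ 1 / 2) (hu : u ∉ A) :
    T / 2 * #(properOn G C A) ≤ Fintype.card C * #(properOn G C (insert u A)) := by
  have hbiased := card_mul_card_properOn_insert (G := G) (C := C) hu fun _ => True
  simp only [filter_true] at hbiased
  have hmany : (#(properOn G C A) : ℝ) / 2 ≤
      #{f ∈ properOn G C A | ¬(#(freeColours G f A u) : ℝ) < T} := by
    have hsplit : (#{f ∈ properOn G C A | (#(freeColours G f A u) : ℝ) < T} : ℝ) +
        #{f ∈ properOn G C A | ¬(#(freeColours G f A u) : ℝ) < T} = #(properOn G C A) := by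
      exact_mod_cast card_filter_add_card_filter_not (s := properOn G C A) _
    have hfew : (#{f ∈ properOn G C A | (#(freeColours G f A u) : ℝ) < T} : ℝ) ≤
        1 / 2 * #(properOn G C A) := h.trans (by gcongr)
    linarith
  calc T / 2 * #(properOn G C A) = #(properOn G C A) / 2 * T := by ring
    _ ≤ #{f ∈ properOn G C A | ¬(#(freeColours G f A u) : ℝ) < T} * T := by gcongr
    _ ≤ ∑ f ∈ properOn G C A, (#(freeColours G f A u) : ℝ) :=
        card_filter_mul_le_sum (fun f _ => Nat.cast_nonneg _) fun f _ => not_lt.1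
    _ = Fintype.card C * #(properOn G C (insert u A)) := by exact_mod_cast hbiased.symm

lemma MostlyFree.card_few_free_le [Nonempty C] (h : MostlyFree G C T q A u)
    (hq0 : 0 ≤ q) (hq : q ≤ 1 / 2) (ht : 0 ≤ t) (htT : t ≤ T) (hu : u ∉ A) :
    T * #{f ∈ properOn G C (insert u A) | (#(freeColours G f A u) : ℝ) < t} ≤
      2 * t * q * #(properOn G C (insert u A)) := by
  have hC : (0 : ℝ) < Fintype.card C := Nat.cast_pos.2 Fintype.card_pos
  have hbiased := card_mul_card_properOn_insert (G := G) (C := C) hu fun n => (n : ℝ) < t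
  have hsum : (∑ f ∈ properOn G C A with (#(freeColours G f A u) : ℝ) < t,
      (#(freeColours G f A u) : ℝ)) ≤
      #{f ∈ properOn G C A | (#(freeColours G f A u) : ℝ) < t} * t := by
    rw [← nsmul_eq_mul]
    exact sum_le_card_nsmul _ _ t fun f hf => (mem_filter.1 hf).2.le
  have hfew : (#{f ∈ properOn G C A | (#(freeColours G f A u) : ℝ) < t} : ℝ) ≤
      q * #(properOn G C A) :=
    le_trans (Nat.cast_le.2 (card_le_card (monotone_filter_right _ fun f _ hf =>
      hf.trans_le htT))) h
  refine le_of_mul_le_mul_left ?_ hC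
  calc (Fintype.card C : ℝ) *
        (T * #{f ∈ properOn G C (insert u A) | (#(freeColours G f A u) : ℝ) < t})
      = T * ∑ f ∈ properOn G C A with (#(freeColours G f A u) : ℝ) < t,
          (#(freeColours G f A u) : ℝ) := by
        rw [mul_left_comm, ← Nat.cast_mul, hbiased, Nat.cast_sum]
    _ ≤ T * (q * #(properOn G C A) * t) :=
        mul_le_mul_of_nonneg_left (hsum.trans (mul_le_mul_of_nonneg_right hfew ht))
          (ht.trans htT)
    _ = 2 * t * q * (T / 2 * #(properOn G C A)) := by ring
    _ ≤ 2 * t * q * (Fintype.card C * #(properOn G C (insert u A))) :=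
        mul_le_mul_of_nonneg_left (h.card_properOn_le (ht.trans htT) hq hu) (by positivity)
    _ = _ := by ring

end SizeBiasing

section Induction

variable {T q t κ : ℝ}

/-- Conditionally on the colours outside the neighbourhood of `v`, its neighbours choose their
colours independently from their lists, because they are pairwise non-adjacent. -/
lemma card_updateFinset_few_free_and_few_short_le (hG : G.CliqueFree 3) (ht : 1 < t) (hκ : 0 < κ)
    (T : ℝ) (A : Finset V) (v : V) (f : V → C) :
    (#{g : nbrsIn G A v → C | updateFinset f (nbrsIn G A v) g ∈ {f ∈ properOn G C A |
        t * #{u ∈ nbrsIn G A v | (#(freeColours G f A u) : ℝ) < t} ≤ Fintype.card C - κ ∧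
          (#(freeColours G f A v) : ℝ) < T}} : ℝ) ≤
      Real.exp (T - κ * Real.exp (-(G.maxDegree * (t / (t - 1)) / κ)) / 2) *
        #{g : nbrsIn G A v → C | updateFinset f (nbrsIn G A v) g ∈ properOn G C A} := by
  set L : nbrsIn G A v → Finset C := fun u => freeColours G f (A \ nbrsIn G A v) u
  have hshort : ∀ g, #{u ∈ nbrsIn G A v |
      (#(freeColours G (updateFinset f (nbrsIn G A v) g) A u) : ℝ) < t} =
      #{i | (#(L i) : ℝ) < t} := fun g => by
    rw [card_filter, card_filter, ← sum_coe_sort]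
    exact sum_congr rfl fun u _ => by rw [freeColours_updateFinset hG u.2]
  have hproper : ∀ g, updateFinset f (nbrsIn G A v) g ∈ properOn G C A ↔
      f ∈ properOn G C (A \ nbrsIn G A v) ∧ g ∈ Fintype.piFinset L :=
    updateFinset_mem_properOn hG f
  simp only [mem_filter, hproper, freeColours_updateFinset_self, hshort]
  by_cases hf : f ∈ properOn G C (A \ nbrsIn G A v) ∧
      t * #{i | (#(L i) : ℝ) < t} ≤ Fintype.card C - κ
  · have hdeg : (Fintype.card (nbrsIn G A v) : ℝ) ≤ G.maxDegree := by
      exact_mod_cast (Fintype.card_coe _).trans_le (card_nbrsIn_le_maxDegree A v)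
    simpa only [hf, true_and, ← filter_filter, filter_univ_mem] using
      card_piFinset_filter_unused_lt_le_of_few_short L ht hκ hdeg hf.2 T
  · rw [filter_false_of_mem fun g _ hg => hf ⟨hg.1.1, hg.2.1⟩, card_empty, Nat.cast_zero]
    positivity

lemma card_few_free_and_few_short_le [Nonempty C] (hG : G.CliqueFree 3) (ht : 1 < t)
    (hκ : 0 < κ) (T : ℝ) (A : Finset V) (v : V) :
    (#{f ∈ properOn G C A |
        t * #{u ∈ nbrsIn G A v | (#(freeColours G f A u) : ℝ) < t} ≤ Fintype.card C - κ ∧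
          (#(freeColours G f A v) : ℝ) < T} : ℝ) ≤
      Real.exp (T - κ * Real.exp (-(G.maxDegree * (t / (t - 1)) / κ)) / 2) *
        #(properOn G C A) :=
  card_le_mul_card_of_forall_updateFinset (nbrsIn G A v)
    (card_updateFinset_few_free_and_few_short_le hG ht hκ T A v)

lemma card_many_short_le [Nonempty C] {m : ℝ} (hm : 0 < m) (hq0 : 0 ≤ q) (hq : q ≤ 1 / 2)
    (ht : 0 < t) (htT : t ≤ T) (hmT : 4 * G.maxDegree * t ^ 2 ≤ m * T)
    (ih : ∀ u ∈ A, MostlyFree G C T q (A.erase u) u) (v : V) :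
    (#{f ∈ properOn G C A | m < t * #{u ∈ nbrsIn G A v | (#(freeColours G f A u) : ℝ) < t}} : ℝ) ≤
      q / 2 * #(properOn G C A) := by
  have hshort : ∀ u ∈ nbrsIn G A v,
      T * #{f ∈ properOn G C A | (#(freeColours G f A u) : ℝ) < t} ≤
        2 * t * q * #(properOn G C A) := fun u hu => by
    have huA := (mem_nbrsIn.1 hu).1
    simpa only [insert_erase huA, freeColours_erase_self] using
      (ih u huA).card_few_free_le hq0 hq ht.le htT (notMem_erase u A)
  have hmarkov : (#{f ∈ properOn G C A |
      m < t * #{u ∈ nbrsIn G A v | (#(freeColours G f A u) : ℝ) < t}} : ℝ) * m ≤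
      ∑ f ∈ properOn G C A, t * #{u ∈ nbrsIn G A v | (#(freeColours G f A u) : ℝ) < t} :=
    card_filter_mul_le_sum (fun f _ => by positivity) fun f _ => le_of_lt
  have hswap : ∑ f ∈ properOn G C A, t * #{u ∈ nbrsIn G A v | (#(freeColours G f A u) : ℝ) < t} =
      t * ∑ u ∈ nbrsIn G A v, (#{f ∈ properOn G C A | (#(freeColours G f A u) : ℝ) < t} : ℝ) := by
    rw [← mul_sum, ← Nat.cast_sum, ← Nat.cast_sum]
    exact congrArg (fun n : ℕ => t * n) (sum_card_bipartiteAbove_eq_sum_card_bipartiteBelow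
      fun f u => (#(freeColours G f A u) : ℝ) < t)
  have hdeg : (#(nbrsIn G A v) : ℝ) ≤ G.maxDegree := by
    exact_mod_cast card_nbrsIn_le_maxDegree A v
  refine le_of_mul_le_mul_right ?_ (mul_pos hm (ht.trans_le htT))
  calc _ ≤ t * ∑ u ∈ nbrsIn G A v,
        T * (#{f ∈ properOn G C A | (#(freeColours G f A u) : ℝ) < t} : ℝ) := by
        rw [← mul_assoc, ← mul_sum, mul_left_comm, mul_comm T, ← hswap]
        exact mul_le_mul_of_nonneg_right hmarkov (ht.trans_le htT).le
    _ ≤ t * (#(nbrsIn G A v) * (2 * t * q * #(properOn G C A))) := by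
        rw [← nsmul_eq_mul]
        exact mul_le_mul_of_nonneg_left (sum_le_card_nsmul _ _ _ hshort) ht.le
    _ ≤ t * (G.maxDegree * (2 * t * q * #(properOn G C A))) := by gcongr
    _ = 4 * G.maxDegree * t ^ 2 * (q / 2 * #(properOn G C A)) := by ring
    _ ≤ m * T * (q / 2 * #(properOn G C A)) := by gcongr
    _ = _ := by ring

theorem mostlyFree (hG : G.CliqueFree 3) (ht : 1 < t) (htT : t ≤ T) (hκ : 0 < κ)
    (hκC : κ < Fintype.card C) (hq : q ≤ 1 / 2)
    (hmT : 4 * G.maxDegree * t ^ 2 ≤ (Fintype.card C - κ) * T)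
    (htail : Real.exp (T - κ * Real.exp (-(G.maxDegree * (t / (t - 1)) / κ)) / 2) ≤ q / 2)
    (A : Finset V) (v : V) : MostlyFree G C T q A v := by
  have : Nonempty C := Fintype.card_pos_iff.1 (Nat.cast_pos.1 (hκ.trans hκC))
  have hq0 : 0 ≤ q := by linarith [Real.exp_pos (T - κ *
    Real.exp (-(G.maxDegree * (t / (t - 1)) / κ)) / 2)]
  induction A using Finset.strongInduction generalizing v with
  | H A ih =>
    have hmany := card_many_short_le (sub_pos.2 hκC) hq0 hq (zero_lt_one.trans ht) htT hmT
      (fun u hu => ih _ (erase_ssubset hu) u) v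
    have hfew := (card_few_free_and_few_short_le (C := C) hG ht hκ T A v).trans
      (mul_le_mul_of_nonneg_right htail (Nat.cast_nonneg _))
    refine le_trans ?_ ((add_le_add hmany hfew).trans_eq (by ring))
    rw [← Nat.cast_add]
    refine Nat.cast_le.2 ((card_le_card fun f hf => ?_).trans (card_union_le _ _))
    rw [mem_filter] at hf
    rw [mem_union, mem_filter, mem_filter]
    exact (lt_or_ge _ _).imp (fun h => ⟨hf.1, h⟩) fun h => ⟨hf.1, h, hf.2⟩

lemma properOn_nonempty [Nonempty C] (hT : 0 < T) (hq : q ≤ 1 / 2)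
    (h : ∀ A v, MostlyFree G C T q A v) (A : Finset V) : (properOn G C A).Nonempty := by
  induction A using Finset.induction_on with
  | empty => exact ⟨fun _ => Classical.arbitrary C, mem_properOn.2 fun x hx =>
      absurd hx (notMem_empty x)⟩
  | insert u A hu ih =>
    have hpos : 0 < T / 2 * #(properOn G C A) :=
      mul_pos (half_pos hT) (Nat.cast_pos.2 ih.card_pos)
    have hins := hpos.trans_le ((h A u).card_properOn_le hT.le hq hu)
    exact card_pos.1 (Nat.cast_pos.1 (pos_of_mul_pos_right hins (Nat.cast_nonneg _)))

end Induction

end PartialColourings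

section Transfer

variable {V : Type u} [Fintype V] [DecidableEq V] {G : SimpleGraph V} [DecidableRel G.Adj] {k : ℕ}

/-- A colouring of `univ.erase v`, in the encoding of `properOn`, is a proper colouring of `G ∖ v`
together with an arbitrary colour for `v`. -/
def properOnEraseEquiv (G : SimpleGraph V) [DecidableRel G.Adj] (k : ℕ) (v : V) :
    {f // f ∈ properOn G (Fin k) (univ.erase v)} ≃
      (deleteVertex G v).Coloring (Fin k) × Fin k where
  toFun f := (SimpleGraph.Coloring.mk (fun x => f.1 x) fun {x y} hxy =>
    mem_properOn.1 f.2 x (mem_erase.2 ⟨x.2, mem_univ _⟩) y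
      (mem_erase.2 ⟨y.2, mem_univ _⟩) hxy, f.1 v)
  invFun p := ⟨fun x => if h : x = v then p.2 else p.1 ⟨x, h⟩, by
    refine mem_properOn.2 fun x hx y hy hxy => ?_
    rw [dif_neg (ne_of_mem_erase hx), dif_neg (ne_of_mem_erase hy)]
    exact p.1.valid hxy⟩
  left_inv f := by
    refine Subtype.ext (funext fun x => ?_)
    by_cases h : x = v
    · exact (dif_pos h).trans (congrArg f.1 h.symm)
    · exact dif_neg h
  right_inv p := Prod.ext (DFunLike.ext _ _ fun x => dif_neg x.2) (dif_pos rfl)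

lemma listSize_properOnEraseEquiv (v : V) (f : {f // f ∈ properOn G (Fin k) (univ.erase v)}) :
    listSize G v (properOnEraseEquiv G k v f).1 = #(freeColours G f.1 (univ.erase v) v) := by
  rw [listSize, ← Set.ncard_coe_finset]
  congr 1
  ext c
  simp only [availableColours, Set.mem_sdiff, Set.mem_univ, true_and, Set.mem_image,
    Set.mem_ofPred_eq, mem_coe, mem_freeColours, mem_nbrsIn, not_exists, not_and]
  constructor
  · exact fun h u ⟨hu, hvu⟩ => h ⟨u, ne_of_mem_erase hu⟩ hvu
  · exact fun h ⟨u, hu⟩ hvu => h u ⟨mem_erase.2 ⟨hu, mem_univ u⟩, hvu⟩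

lemma card_filter_properOn_erase (v : V) (P : ℕ → Prop) [DecidablePred P] :
    #{f ∈ properOn G (Fin k) (univ.erase v) | P #(freeColours G f (univ.erase v) v)} =
      Nat.card {σ : (deleteVertex G v).Coloring (Fin k) // P (listSize G v σ)} * k := by
  calc _ = Nat.card {f // f ∈ properOn G (Fin k) (univ.erase v) ∧
          P #(freeColours G f (univ.erase v) v)} :=
        (Nat.subtype_card _ fun f => mem_filter).symm
    _ = Nat.card {f : {f // f ∈ properOn G (Fin k) (univ.erase v)} //
          P #(freeColours G f.1 (univ.erase v) v)} :=
        Nat.card_congr (Equiv.subtypeSubtypeEquivSubtypeInter _ _).symm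
    _ = Nat.card {p : (deleteVertex G v).Coloring (Fin k) × Fin k // P (listSize G v p.1)} :=
        Nat.card_congr ((properOnEraseEquiv G k v).subtypeEquiv fun f => by
          rw [listSize_properOnEraseEquiv])
    _ = Nat.card ({σ : (deleteVertex G v).Coloring (Fin k) // P (listSize G v σ)} × Fin k) :=
        Nat.card_congr (Equiv.prodSubtypeFstEquivSubtypeProd (p := fun σ => P (listSize G v σ)))
    _ = _ := by rw [Nat.card_prod, Nat.card_fin]

lemma prob_uniformColouring {W : Type u} [Finite W] (H : SimpleGraph W) (k : ℕ)
    [Nonempty (H.Coloring (Fin k))] (S : Set (H.Coloring (Fin k))) :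
    prob (uniformColouring H k) S = Nat.card S / Nat.card (H.Coloring (Fin k)) := by
  have : Finite (H.Coloring (Fin k)) := DFunLike.finite _
  let _ := Fintype.ofFinite (H.Coloring (Fin k))
  let _ := Fintype.ofFinite S
  rw [prob, uniformColouring, PMF.toOuterMeasure_uniformOfFintype_apply, ENNReal.toReal_div,
    ENNReal.toReal_natCast, ENNReal.toReal_natCast, Nat.card_eq_fintype_card,
    Nat.card_eq_fintype_card]

lemma MostlyFree.prob_le {T q : ℝ} {v : V} [NeZero k]
    [Nonempty ((deleteVertex G v).Coloring (Fin k))]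
    (h : MostlyFree G (Fin k) T q (univ.erase v) v) :
    prob (uniformColouring (deleteVertex G v) k) {σ | (listSize G v σ : ℝ) < T} ≤ q := by
  have : Finite ((deleteVertex G v).Coloring (Fin k)) := DFunLike.finite _
  have hall := card_filter_properOn_erase (G := G) (k := k) v fun _ => True
  rw [filter_true, Nat.card_congr (Equiv.subtypeUnivEquiv fun _ => trivial)] at hall
  rw [MostlyFree, card_filter_properOn_erase v fun n => (n : ℝ) < T, hall, Nat.cast_mul,
    Nat.cast_mul, ← mul_assoc] at h
  rw [prob_uniformColouring, div_le_iff₀ (Nat.cast_pos.2 Nat.card_pos)]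
  exact le_of_mul_le_mul_right h (Nat.cast_pos.2 (NeZero.pos k))

lemma exists_nonempty_prob_le_of_mostlyFree [NeZero k] {T q : ℝ} (hT : 0 < T) (hq : q ≤ 1 / 2)
    (h : ∀ A v, MostlyFree G (Fin k) T q A v) (v : V) :
    ∃ _ : Nonempty ((deleteVertex G v).Coloring (Fin k)),
      prob (uniformColouring (deleteVertex G v) k) {σ | (listSize G v σ : ℝ) < T} ≤ q := by
  obtain ⟨f, hf⟩ := properOn_nonempty hT hq h (univ.erase v)
  have hne : Nonempty ((deleteVertex G v).Coloring (Fin k)) :=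
    ⟨(properOnEraseEquiv G k v ⟨f, hf⟩).1⟩
  exact ⟨hne, (h (univ.erase v) v).prob_le⟩

end Transfer

section Prob

variable {Ω : Type u} {p : PMF Ω}

lemma prob_mono {A B : Set Ω} (h : A ⊆ B) : prob p A ≤ prob p B :=
  ENNReal.toReal_mono (by rw [PMF.toOuterMeasure_apply]; exact p.tsum_coe_indicator_ne_top B)
    (p.toOuterMeasure.mono h)

lemma prob_lt_one_sub_mul_le {X : Ω → ℝ} {ℓ δ : ℝ} (hℓ : 0 ≤ ℓ) (hδ : δ ∈ Set.Ioo (0 : ℝ) 1)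
    (h : prob p {ω | X ω < ℓ} ≤ 2 * Real.exp (-ℓ)) :
    prob p {ω | X ω < (1 - δ) * ℓ} ≤ 2 * Real.exp (-(δ ^ 2 * ℓ / 2)) := by
  obtain ⟨hδ0, hδ1⟩ := hδ
  have hthreshold : (1 - δ) * ℓ ≤ ℓ := mul_le_of_le_one_left hℓ (by linarith)
  have hexponent : δ ^ 2 * ℓ / 2 ≤ ℓ := by
    linarith [mul_le_of_le_one_left hℓ (pow_le_one₀ hδ0.le hδ1.le : δ ^ 2 ≤ 1)]
  calc prob p {ω | X ω < (1 - δ) * ℓ} ≤ prob p {ω | X ω < ℓ} :=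
        prob_mono fun ω hω => lt_of_lt_of_le hω hthreshold
    _ ≤ 2 * Real.exp (-ℓ) := h
    _ ≤ 2 * Real.exp (-(δ ^ 2 * ℓ / 2)) := by gcongr

end Prob

section Parameters

open Filter

lemma eventually_mul_log_le_mul_rpow {c r : ℝ} (a : ℝ) (hc : 0 < c) (hr : 0 < r) :
    ∀ᶠ k : ℕ in atTop, a * Real.log k ≤ c * (k : ℝ) ^ r := by
  filter_upwards [tendsto_natCast_atTop_atTop.eventually
    (((isLittleO_log_rpow_atTop hr).const_mul_left a).bound hc)] with k hk
  rw [Real.norm_of_nonneg (Real.rpow_nonneg (Nat.cast_nonneg k) r)] at hk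
  exact (le_abs_self _).trans hk

lemma eventually_le_rpow {r : ℝ} (hr : 0 < r) (a : ℝ) : ∀ᶠ k : ℕ in atTop, a ≤ (k : ℝ) ^ r :=
  ((tendsto_rpow_atTop hr).comp tendsto_natCast_atTop_atTop).eventually_ge_atTop a

lemma eventually_mul_log_rpow_le_rpow {η η' : ℝ} (hη : 0 < η) (hη' : η < η') :
    ∀ᶠ k : ℕ in atTop, ((k : ℝ) * Real.log k) ^ η ≤ (k : ℝ) ^ η' := by
  filter_upwards [eventually_gt_atTop 0,
    eventually_mul_log_le_mul_rpow 1 one_pos (div_pos (sub_pos.2 hη') hη)] with k hk hlog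
  have hk0 : (0 : ℝ) < k := Nat.cast_pos.2 hk
  rw [one_mul, one_mul] at hlog
  calc ((k : ℝ) * Real.log k) ^ η ≤ ((k : ℝ) * (k : ℝ) ^ ((η' - η) / η)) ^ η := by
        have := Real.log_natCast_nonneg k
        gcongr
    _ = (k : ℝ) ^ η' := by
        rw [← Real.rpow_one_add' hk0.le (by positivity), ← Real.rpow_mul hk0.le]
        congr 1
        field_simp
        ring

lemma le_of_sq_le_mul_log {m k : ℕ} (h : (m : ℝ) ^ 2 ≤ k * Real.log k) : m ≤ k := by
  have hsq : (m : ℝ) ^ 2 ≤ (k : ℝ) ^ 2 := by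
    rw [sq (k : ℝ)]
    exact h.trans (mul_le_mul_of_nonneg_left (Real.log_le_self k.cast_nonneg) k.cast_nonneg)
  exact Nat.cast_le.1 ((pow_le_pow_iff_left₀ m.cast_nonneg k.cast_nonneg two_ne_zero).1 hsq)

lemma rpow_le_mul_exp_neg_of_le {ε θ k D : ℝ} (hθ : 0 ≤ θ) (hθε : θ ≤ ε) (hθ1 : θ < 1)
    (hk : 1 ≤ k) (hD : D ≤ (1 - ε) * k * Real.log k) :
    k ^ (ε - 2 * θ) ≤ k * Real.exp (-(D * (1 + θ) / ((1 - θ) * k))) := by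
  have hk0 : 0 < k := zero_lt_one.trans_le hk
  have hratio : D * (1 + θ) / ((1 - θ) * k) ≤ (1 - (ε - 2 * θ)) * Real.log k := by
    rw [div_le_iff₀ (mul_pos (sub_pos.2 hθ1) hk0)]
    calc D * (1 + θ) ≤ (1 - ε) * k * Real.log k * (1 + θ) := by gcongr
      _ = (1 - ε) * (1 + θ) * (k * Real.log k) := by ring
      _ ≤ (1 - (ε - 2 * θ)) * (1 - θ) * (k * Real.log k) :=
          mul_le_mul_of_nonneg_right (by nlinarith) (mul_nonneg hk0.le (Real.log_nonneg hk))
      _ = _ := by ring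
  calc k ^ (ε - 2 * θ) = k * Real.exp (-((1 - (ε - 2 * θ)) * Real.log k)) := by
        nth_rewrite 2 [← Real.exp_log hk0]
        rw [← Real.exp_add, Real.rpow_def_of_pos hk0]
        congr 1
        ring
    _ ≤ _ := by gcongr

lemma two_mul_rpow_le_mul_exp_neg_div_two {ε θ k D : ℝ} (hθ : 0 ≤ θ) (hθε : θ ≤ ε)
    (hθ2 : θ ≤ 1 / 2) (hk : 1 ≤ k) (h8 : 8 ≤ k ^ (2 * θ)) (hD : D ≤ (1 - ε) * k * Real.log k) :
    2 * k ^ (ε - 4 * θ) ≤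
      (1 - θ) * k * Real.exp (-(D * (1 + θ) / ((1 - θ) * k))) / 2 := by
  have hk0 : 0 < k := zero_lt_one.trans_le hk
  calc 2 * k ^ (ε - 4 * θ) = 8 * k ^ (ε - 4 * θ) / 4 := by ring
    _ ≤ k ^ (2 * θ) * k ^ (ε - 4 * θ) / 4 := by gcongr
    _ = 1 / 2 * k ^ (ε - 2 * θ) / 2 := by
        rw [← Real.rpow_add hk0]
        ring_nf
    _ ≤ (1 - θ) * (k * Real.exp (-(D * (1 + θ) / ((1 - θ) * k)))) / 2 := by
        have hbound := rpow_le_mul_exp_neg_of_le hθ hθε (by linarith) hk hD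
        gcongr <;> linarith
    _ = _ := by ring

lemma two_mul_exp_neg_le_half {x : ℝ} (hx : 3 ≤ x) : 2 * Real.exp (-x) ≤ 1 / 2 := by
  have hexp : (4 : ℝ) ≤ Real.exp x := by linarith [Real.add_one_le_exp x]
  rw [Real.exp_neg]
  linarith [inv_anti₀ (by norm_num) hexp]

lemma eventually_forall_mostlyFree {ε η : ℝ} (hε : ε < 1) (hη : η ∈ Set.Ioo 0 ε) :
    ∀ᶠ k : ℕ in atTop, ∀ (V : Type u) [Fintype V] [DecidableEq V] (G : SimpleGraph V)
      [DecidableRel G.Adj], G.CliqueFree 3 → (G.maxDegree : ℝ) ≤ (1 - ε) * k * Real.log k →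
        ∀ A v, MostlyFree G (Fin k) ((k : ℝ) ^ η) (2 * Real.exp (-(k : ℝ) ^ η)) A v := by
  obtain ⟨hη0, hηε⟩ := hη
  obtain ⟨θ, rfl⟩ : ∃ θ, η = ε - 4 * θ := ⟨(ε - η) / 4, by ring⟩
  have hθ : 0 < θ := by linarith
  set t : ℝ := 1 + 1 / θ with ht
  have ht1 : 1 < t := lt_add_of_pos_right 1 (one_div_pos.2 hθ)
  have htratio : t / (t - 1) = 1 + θ := by
    rw [ht]
    field_simp
    ring
  filter_upwards [eventually_ge_atTop 1, eventually_le_rpow hη0 t, eventually_le_rpow hη0 3,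
    eventually_mul_log_le_mul_rpow (4 * t ^ 2) hθ hη0,
    eventually_le_rpow (mul_pos two_pos hθ) 8] with k hk htT h3 hlog h8 V _ _ G _ hG hdeg
  have hk1 : (1 : ℝ) ≤ k := Nat.one_le_cast.2 hk
  have : 0 ≤ k * Real.log k := mul_nonneg k.cast_nonneg (Real.log_nonneg hk1)
  refine mostlyFree (t := t) (κ := (1 - θ) * k) hG ht1 htT (by nlinarith) ?_
    (two_mul_exp_neg_le_half h3) ?_ ?_
  · rw [Fintype.card_fin]
    nlinarith
  · rw [Fintype.card_fin]
    calc 4 * G.maxDegree * t ^ 2 ≤ 4 * (k * Real.log k) * t ^ 2 := by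
          gcongr
          nlinarith
      _ = k * (4 * t ^ 2 * Real.log k) := by ring
      _ ≤ k * (θ * k ^ (ε - 4 * θ)) := by gcongr
      _ = (k - (1 - θ) * k) * k ^ (ε - 4 * θ) := by ring
  · rw [htratio, mul_div_cancel_left₀ _ two_ne_zero, Real.exp_le_exp]
    linarith [two_mul_rpow_le_mul_exp_neg_div_two hθ.le (by linarith) (by linarith) hk1 h8 hdeg]

theorem eventually_forall_prob_listSize_lt_rpow_le {ε η : ℝ} (hε : ε < 1)
    (hη : η ∈ Set.Ioo 0 ε) :
    ∀ᶠ k : ℕ in atTop, ∀ (V : Type u) [Fintype V] (G : SimpleGraph V) [DecidableRel G.Adj],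
      G.CliqueFree 3 → (G.maxDegree : ℝ) ≤ (1 - ε) * k * Real.log k → ∀ v : V,
        ∃ _ : Nonempty ((deleteVertex G v).Coloring (Fin k)),
          prob (uniformColouring (deleteVertex G v) k) {σ | (listSize G v σ : ℝ) < (k : ℝ) ^ η} ≤
            2 * Real.exp (-(k : ℝ) ^ η) := by
  filter_upwards [eventually_gt_atTop 0, eventually_le_rpow hη.1 3,
    eventually_forall_mostlyFree hε hη] with k hk h3 hfree V _ G _ hG hdeg v
  classical
  have : NeZero k := ⟨hk.ne'⟩
  exact exists_nonempty_prob_le_of_mostlyFree (zero_lt_three.trans_le h3)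
    (two_mul_exp_neg_le_half h3) (hfree V G hG hdeg) v

end Parameters

end SparseColouring

open SparseColouring

theorem mainTheorem10_general (ε η : ℝ) (hε : ε < 1) (hη : η ∈ Set.Ioo 0 ε) :
    ∃ Δ₀ : ℕ, ∀ Δ : ℕ, Δ₀ ≤ Δ →
      ∀ k : ℕ, (Δ : ℝ) ≤ (1 - ε) * k * Real.log k →
      ∀ (V : Type u) [Fintype V] (G : SimpleGraph V) [DecidableRel G.Adj],
        G.CliqueFree 3 → G.maxDegree ≤ Δ →
      ∀ v : V,
        ∃ _ : Nonempty ((deleteVertex G v).Coloring (Fin k)),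
          prob (uniformColouring (deleteVertex G v) k)
              {σ | (listSize G v σ : ℝ) < (Δ : ℝ) ^ η}
            ≤ 2 * Real.exp (-(Δ : ℝ) ^ η) := by
  obtain ⟨hη0, hηε⟩ := hη
  obtain ⟨η', hηη', hη'ε⟩ := exists_between hηε
  obtain ⟨k₀, hk₀⟩ := Filter.eventually_atTop.1
    ((eventually_forall_prob_listSize_lt_rpow_le hε ⟨hη0.trans hηη', hη'ε⟩).and
      (eventually_mul_log_rpow_le_rpow hη0 hηη'))
  refine ⟨k₀ ^ 2, fun Δ hΔ k hk V _ G _ hG hdeg v => ?_⟩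
  have hΔlog : (Δ : ℝ) ≤ k * Real.log k := by
    nlinarith [mul_nonneg k.cast_nonneg (Real.log_natCast_nonneg k)]
  have hsq : (k₀ : ℝ) ^ 2 ≤ Δ := by exact_mod_cast hΔ
  have hk₀k : k₀ ≤ k := le_of_sq_le_mul_log (hsq.trans hΔlog)
  obtain ⟨hmain, hrpow⟩ := hk₀ k hk₀k
  have hpow : (Δ : ℝ) ^ η ≤ (k : ℝ) ^ η' :=
    (Real.rpow_le_rpow Δ.cast_nonneg hΔlog hη0.le).trans hrpow
  refine (hmain V G hG ((Nat.cast_le.2 hdeg).trans hk) v).imp fun _ hprob => ?_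
  exact (prob_mono fun σ hσ => lt_of_lt_of_le hσ hpow).trans (hprob.trans (by gcongr))

theorem mainTheorem10 (ε : ℝ) (hε : ε ∈ Set.Ioo (0 : ℝ) 1) :
    ∃ Δ₀ : ℕ, ∀ Δ : ℕ, Δ₀ ≤ Δ →
      ∀ k : ℕ, (Δ : ℝ) ≤ (1 - ε) * k * Real.log k →
      ∀ (V : Type u) [Fintype V] (G : SimpleGraph V) [DecidableRel G.Adj],
        G.CliqueFree 3 → G.maxDegree ≤ Δ →
      ∀ δ ∈ Set.Ioo (0 : ℝ) 1, ∀ v : V,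
        ∃ _ : Nonempty ((SparseColouring.deleteVertex G v).Coloring (Fin k)),
          SparseColouring.prob
              (SparseColouring.uniformColouring (SparseColouring.deleteVertex G v) k)
              {σ | (SparseColouring.listSize G v σ : ℝ) < (1 - δ) * (Δ : ℝ) ^ (ε / 2)}
            ≤ 2 * Real.exp (-(δ ^ 2 * (Δ : ℝ) ^ (ε / 2) / 2)) :=
  (mainTheorem10_general ε (ε / 2) hε.2 ⟨half_pos hε.1, half_lt_self hε.1⟩).imp
    fun _ h Δ hΔ k hk V _ G _ hG hdeg _ hδ v =>
      (h Δ hΔ k hk V G hG hdeg v).imp fun _ hprob =>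
        prob_lt_one_sub_mul_le (Real.rpow_nonneg Δ.cast_nonneg _) hδ hprob
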